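/- Let $Q$ be a smooth finite-dimensional manifold with smooth Riemannian metric $g=\langle\cdot,\cdot\rangle$ and Levi-Civita connection $\nabla$, let $V\in C^\infty(Q)$, and let $\mathcal F\subseteq T^*Q$ be a smooth codistribution of rank $m$. The simple mechanical control system $\Sigma=(Q,g,V,\mathcal F)$ is the control system on $TQ$ with inputs $F_q\in\mathcal F_q$ at the state $v_q\in T_qQ$, defined by $\nabla_{\dot q}\dot q=-\operatorname{grad}V_q+F_q^\sharp$; write $\Phi(v_q,F_q)\in T_{v_q}(TQ)$ for the corresponding tangent vector. Let $\mathcal U_qQ=\{v\in T_qQ:\langle F;v\rangle=0\ \forall F\in\mathcal F_q\}$ be the unactuated distribution, $\mathcal A_qQ=(\mathcal U_qQ)^\perp$ the actuated one, and $v\mapsto v^{\mathcal A}$ the $g$-orthogonal projection onto $\mathcal A_qQ$. A function $\alpha:\mathbb R\to\mathbb R$ is of class $\mathcal K_\infty^e$ if it is continuous and strictly increasing with $\alpha(0)=0$ and $\lim_{r\to\pm\infty}\alpha(r)=\pm\infty$. For a control system with state manifold $M$, input sets $U_p$ and dynamics $\Phi(u_p)\in T_pM$, a function $h\in C^\infty(M)$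 is a control barrier function (CBF) on an open set $D\supseteq\{h\ge 0\}$ with the locally Lipschitz function $\alpha\in\mathcal K_\infty^e$ if $\sup_{u_p\in U_p}dh_p\,\Phi(u_p)>-\alpha(h(p))$ for all $p\in D$. The single integrator on $Q$ has $U_q=T_qQ$ and $\Phi=\mathrm{id}$. Theorem. Let $h_0\in C^\infty(Q)$ have $0$ as a regular value, and let $\mathcal C_0=\{h_0\ge 0\}$. (1) Let $\alpha\in\mathcal K_\infty^e$ be locally Lipschitz, $D_0\supseteq\mathcal C_0$ open, and $\kappa$ a smooth vector field on $Q$ with $d(h_0)_q\kappa_q>-\alpha(h_0(q))$ for all $q\in D_0$. If $\mathcal U_qQ\subseteq\ker d(h_0)_q$ for all $q\in D_0$, then for every $\varepsilon>0$ the function $$h(v_q)=h_0(q)-\frac{\varepsilon}{2}\,\bigl\|(v_q-\kappa_q)^{\mathcal A}\bigr\|^2,\qquad v_q\in TQ,$$ is a CBF for $\Sigma$ on $TD_0\subseteq TQ$, with the same $\alpha$. (2) In particular the conclusion holds, again with the same $\alpha$, for $\kappa=\kappa_{\mathrm{HS}}+\delta\operatorname{grad}h_0$ with any $\delta>0$,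 where: $\alpha\in\mathcal K_\infty^e$ is smooth; $h_0$ is a CBF for the single integrator on an open set $D\supseteq\mathcal C_0$ with $\alpha$; $D_0$ is open with $\mathcal C_0\subseteq D_0\subseteq D$ and $\mathcal U_qQ\subseteq\ker d(h_0)_q$ for all $q\in D_0$; and $\kappa_{\mathrm{HS}}$ is a smooth vector field on $Q$ that on $D_0$ equals the half-Sontag safety filter $$\kappa_{\mathrm{des}}+\lambda(a,b)\operatorname{grad}h_0,\qquad a=\alpha(h_0)+\langle\operatorname{grad}h_0,\kappa_{\mathrm{des}}\rangle,\quad b=\|\operatorname{grad}h_0\|^2,$$ for some smooth vector field $\kappa_{\mathrm{des}}$ on $Q$, with $\lambda(a,0)=0$ and $\lambda(a,b)=\dfrac{-a+\sqrt{a^2+b^2}}{2b}$ for $b\ne 0$. -/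

import Mathlib

open Set Filter Topology
open scoped Manifold ContDiff

noncomputable section

/-! ### Class `K_∞^e` functions and control barrier functions -/

/-- Extended class `K_∞` functions: continuous, strictly increasing, vanishing at `0`, with limits
`± ∞` at `± ∞`. -/
structure IsClassKInftyE (α : ℝ → ℝ) : Prop where
  continuous : Continuous α
  strictMono : StrictMono α
  map_zero : α 0 = 0
  tendsto_atTop : Tendsto α atTop atTop
  tendsto_atBot : Tendsto α atBot atBot

/-- The fibrewise data of a nonlinear control system on a manifold `M`: the set `Input p` of inputs
available at the state `p` (the fibre over `p` of the input bundle), and the dynamics, sending an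
input at `p` to a tangent vector at `p`. -/
structure NonlinearControlSystem {E : Type*} [NormedAddCommGroup E] [NormedSpace ℝ E]
    {H : Type*} [TopologicalSpace H] (I : ModelWithCorners ℝ E H)
    (M : Type*) [TopologicalSpace M] [ChartedSpace H M] where
  Input : M → Type*
  dynamics : ∀ p : M, Input p → TangentSpace I p

section CBF

variable {E : Type*} [NormedAddCommGroup E] [NormedSpace ℝ E]
    {H : Type*} [TopologicalSpace H] {I : ModelWithCorners ℝ E H}
    {M : Type*} [TopologicalSpace M] [ChartedSpace H M]

/-- `h` is a control barrier function for `S` on the open set `D`, with class `K_∞^e` function `α`: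
`h` is smooth, `α` is locally Lipschitz of class `K_∞^e`, `D` is open and contains
`{p | 0 ≤ h p}`, and `sup_u dh_p Φ(u) > - α (h p)` for all `p ∈ D`, the supremum being taken in the
extended reals over all inputs `u` at `p`. -/
structure NonlinearControlSystem.IsCBFOnWith (S : NonlinearControlSystem I M) (h : M → ℝ)
    (D : Set M) (α : ℝ → ℝ) : Prop where
  smooth : ContMDiff I 𝓘(ℝ, ℝ) ∞ h
  classK : IsClassKInftyE α
  locallyLipschitz : LocallyLipschitz α
  isOpen : IsOpen D
  superlevel_subset : {p | 0 ≤ h p} ⊆ D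
  barrier : ∀ p ∈ D,
    ((-α (h p) : ℝ) : EReal) < ⨆ u : S.Input p, ((mvfderiv I h p (S.dynamics p u) : ℝ) : EReal)

variable (I M) in
/-- The single integrator on `M`: inputs at `p` are tangent vectors at `p`, the dynamics is the
identity. -/
def singleIntegrator : NonlinearControlSystem I M where
  Input p := TangentSpace I p
  dynamics _ v := v

end CBF

/-! ### Riemannian manifolds -/

section Chart

variable {E : Type*} [NormedAddCommGroup E] [NormedSpace ℝ E]
    {Q : Type*} [TopologicalSpace Q] [ChartedSpace E Q]

/-- A field `g` of bilinear forms on the tangent spaces, read in the preferred chart `φ` at `q`: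
`chartMetric g q x u w = ∑ uⁱ wʲ gᵢⱼ(x)` with `gᵢⱼ(x) = g (∂ᵢ, ∂ⱼ)` at the point `φ⁻¹ x`. -/
def chartMetric (g : ∀ q : Q, TangentSpace 𝓘(ℝ, E) q →L[ℝ] TangentSpace 𝓘(ℝ, E) q →L[ℝ] ℝ)
    (q : Q) (x : E) : E →L[ℝ] E →L[ℝ] ℝ :=
  let A : E →L[ℝ] TangentSpace 𝓘(ℝ, E) ((extChartAt 𝓘(ℝ, E) q).symm x) :=
    mfderiv 𝓘(ℝ, E) 𝓘(ℝ, E) (extChartAt 𝓘(ℝ, E) q).symm x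
  let B : E →L[ℝ] E →L[ℝ] ℝ := g ((extChartAt 𝓘(ℝ, E) q).symm x)
  B.bilinearComp A A

/-- The derivative at `q` of the coefficients of `g` in the preferred chart at `q`:
`chartMetricDeriv g q u v w = ∑ uⁱ vʲ wᵏ ∂ᵢ gⱼₖ`. -/
def chartMetricDeriv (g : ∀ q : Q, TangentSpace 𝓘(ℝ, E) q →L[ℝ] TangentSpace 𝓘(ℝ, E) q →L[ℝ] ℝ)
    (q : Q) : E →L[ℝ] E →L[ℝ] E →L[ℝ] ℝ :=
  fderiv ℝ (chartMetric g q) (extChartAt 𝓘(ℝ, E) q q)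

/-- The Christoffel symbols of the first kind of `g` at `q`, in the preferred chart at `q`:
`w ↦ ∑ uⁱ vʲ wᵏ (∂ᵢ gⱼₖ + ∂ⱼ gᵢₖ - ∂ₖ gᵢⱼ) / 2`. -/
def christoffelFirst (g : ∀ q : Q, TangentSpace 𝓘(ℝ, E) q →L[ℝ] TangentSpace 𝓘(ℝ, E) q →L[ℝ] ℝ)
    (q : Q) (u v : E) : E →L[ℝ] ℝ :=
  (1 / 2 : ℝ) • (chartMetricDeriv g q u v + chartMetricDeriv g q v u
    - ((chartMetricDeriv g q).flip u).flip v)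

end Chart

section Riemannian

open Bundle

variable {E : Type*} [NormedAddCommGroup E] [NormedSpace ℝ E]
    {Q : Type*} [TopologicalSpace Q] [ChartedSpace E Q]

/-- The first component of a tangent vector to `TQ` is its image under the derivative of the
projection `TQ → Q`. -/
theorem mfderiv_tangentBundle_proj [IsManifold 𝓘(ℝ, E) ∞ Q] (v : TangentBundle 𝓘(ℝ, E) Q)
    (w : TangentSpace 𝓘(ℝ, E).tangent v) :
    mfderiv 𝓘(ℝ, E).tangent 𝓘(ℝ, E) (TotalSpace.proj : TangentBundle 𝓘(ℝ, E) Q → Q) v w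
      = (w : E × E).1 := by
  have hd : MDifferentiableAt 𝓘(ℝ, E).tangent 𝓘(ℝ, E)
      (TotalSpace.proj : TangentBundle 𝓘(ℝ, E) Q → Q) v :=
    (contMDiffAt_proj (n := 1) (TangentSpace 𝓘(ℝ, E))).mdifferentiableAt one_ne_zero
  rw [hd.mfderiv]
  have h : writtenInExtChartAt 𝓘(ℝ, E).tangent 𝓘(ℝ, E) v
      (TotalSpace.proj : TangentBundle 𝓘(ℝ, E) Q → Q)
      =ᶠ[𝓝[range 𝓘(ℝ, E).tangent] (extChartAt 𝓘(ℝ, E).tangent v v)] Prod.fst := by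
    filter_upwards [extChartAt_target_mem_nhdsWithin (I := 𝓘(ℝ, E).tangent) v] with y hy
    have hy1 : y.1 ∈ (extChartAt 𝓘(ℝ, E) v.proj).target := by
      simp only [extChartAt, mfld_simps] at hy ⊢
      exact ((TangentBundle.mem_chart_target_iff y v).1 hy)
    have h2 : ((extChartAt 𝓘(ℝ, E).tangent v).symm y).proj
        = (extChartAt 𝓘(ℝ, E) v.proj).symm y.1 :=
      TangentBundle.coe_chartAt_symm_fst y v
    change extChartAt 𝓘(ℝ, E) v.proj ((extChartAt 𝓘(ℝ, E).tangent v).symm y).proj = y.1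
    rw [h2]
    exact (extChartAt 𝓘(ℝ, E) v.proj).right_inv hy1
  rw [h.fderivWithin_eq_of_mem (by simp)]
  have hr : range 𝓘(ℝ, E).tangent = univ := ModelWithCorners.range_eq_univ _
  rw [hr, fderivWithin_univ, fderiv_fst]
  rfl

section

variable [RiemannianBundle (fun q : Q ↦ TangentSpace 𝓘(ℝ, E) q)]

variable (E) in
/-- The Riemannian metric, as a field of bilinear forms. -/
def metricForm (q : Q) : TangentSpace 𝓘(ℝ, E) q →L[ℝ] TangentSpace 𝓘(ℝ, E) q →L[ℝ] ℝ :=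
  (RiemannianBundle.g (E := fun q : Q ↦ TangentSpace 𝓘(ℝ, E) q)).inner q

theorem metricForm_apply (q : Q) (v w : TangentSpace 𝓘(ℝ, E) q) :
    metricForm E q v w = inner ℝ v w := rfl

end

variable [FiniteDimensional ℝ E]

instance finiteDimensional_tangentSpace (q : Q) : FiniteDimensional ℝ (TangentSpace 𝓘(ℝ, E) q) :=
  inferInstanceAs (FiniteDimensional ℝ E)

variable [RiemannianBundle (fun q : Q ↦ TangentSpace 𝓘(ℝ, E) q)]

instance completeSpace_tangentSpace (q : Q) : CompleteSpace (TangentSpace 𝓘(ℝ, E) q) :=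
  FiniteDimensional.complete ℝ _

/-- The tangent vector `η♯` representing the covector `η`: `⟪η♯, v⟫ = η v` for all `v`. -/
def sharp {q : Q} (η : TangentSpace 𝓘(ℝ, E) q →L[ℝ] ℝ) : TangentSpace 𝓘(ℝ, E) q :=
  (InnerProductSpace.toDual ℝ (TangentSpace 𝓘(ℝ, E) q)).symm η

theorem inner_sharp {q : Q} (η : TangentSpace 𝓘(ℝ, E) q →L[ℝ] ℝ) (v : TangentSpace 𝓘(ℝ, E) q) :
    inner ℝ (sharp η) v = η v :=
  InnerProductSpace.toDual_symm_apply

variable (E) in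
/-- The Riemannian gradient of `f` at `q`. -/
def riemannianGrad (f : Q → ℝ) (q : Q) : TangentSpace 𝓘(ℝ, E) q :=
  sharp (mvfderiv 𝓘(ℝ, E) f q)

/-- The Christoffel symbols `∑ Γᵏᵢⱼ uⁱ vʲ ∂ₖ` of the Levi-Civita connection at `q`, in the preferred
chart at `q`. A tangent vector at `q` is identified with its components in the preferred chart
at `q`: the tangent space at `q` is the model space. -/
def christoffel (q : Q) (u v : TangentSpace 𝓘(ℝ, E) q) : TangentSpace 𝓘(ℝ, E) q :=
  sharp (christoffelFirst (E := E) (metricForm E) q u v)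

variable [IsManifold 𝓘(ℝ, E) ∞ Q]

/-- If `V` is a curve in `TQ` over the curve `q` in `Q`, with `V(0) = v` and velocity `V'(0) = w`
in `T_v(TQ)`, then `connector v w` is the Levi-Civita covariant derivative `∇_{q'(0)} V`, that is
`V'ᵏ + ∑ Γᵏᵢⱼ q'ⁱ Vʲ`. Here `w = (w.1, w.2)` is given by its components in the chart `(qⁱ, Vⁱ)` of
`TQ` induced by the preferred chart at the base point of `v`: this is how tangent vectors to `TQ`
at `v` are represented. -/
def connector (v : TangentBundle 𝓘(ℝ, E) Q) (w : TangentSpace 𝓘(ℝ, E).tangent v) :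
    TangentSpace 𝓘(ℝ, E) v.proj :=
  let w₁ : TangentSpace 𝓘(ℝ, E) v.proj := (w : E × E).1
  let w₂ : TangentSpace 𝓘(ℝ, E) v.proj := (w : E × E).2
  w₂ + christoffel v.proj w₁ v.snd

end Riemannian

/-! ### Simple mechanical control systems -/

section Mechanics

open Bundle

variable {E : Type*} [NormedAddCommGroup E] [NormedSpace ℝ E]
    {Q : Type*} [TopologicalSpace Q] [ChartedSpace E Q]

/-- A smooth codistribution of rank `m`: a subspace of each cotangent space, with smooth local
frames consisting of `m` covector fields. -/
def IsSmoothCodistribution [IsManifold 𝓘(ℝ, E) ∞ Q] (m : ℕ)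
    (F : ∀ q : Q, Submodule ℝ (TangentSpace 𝓘(ℝ, E) q →L[ℝ] ℝ)) : Prop :=
  ∀ q₀ : Q, ∃ U : Set Q, IsOpen U ∧ q₀ ∈ U ∧
    ∃ η : Fin m → ∀ q : Q, TangentSpace 𝓘(ℝ, E) q →L[ℝ] ℝ,
      (∀ i, ContMDiffOn 𝓘(ℝ, E) (𝓘(ℝ, E).prod 𝓘(ℝ, E →L[ℝ] ℝ)) ∞
        (fun q ↦ TotalSpace.mk' (E →L[ℝ] ℝ)
          (E := fun q : Q ↦ TangentSpace 𝓘(ℝ, E) q →L[ℝ] Bundle.Trivial Q ℝ q) q (η i q)) U) ∧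
      ∀ q ∈ U, LinearIndependent ℝ (fun i ↦ η i q) ∧
        Submodule.span ℝ (range fun i ↦ η i q) = F q

variable [FiniteDimensional ℝ E] [IsManifold 𝓘(ℝ, E) ∞ Q]
    [RiemannianBundle (fun q : Q ↦ TangentSpace 𝓘(ℝ, E) q)]

variable (E Q) in
/-- A simple mechanical control system on the manifold `Q` with kinetic energy metric the given
Riemannian metric: the metric is smooth, `V` is the potential and `F` is the input codistribution,
of rank `m`. -/
structure SimpleMechanicalControlSystem (m : ℕ) where
  smooth_metric :
    IsContMDiffRiemannianBundle 𝓘(ℝ, E) ∞ E (fun q : Q ↦ TangentSpace 𝓘(ℝ, E) q)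
  V : Q → ℝ
  smooth_V : ContMDiff 𝓘(ℝ, E) 𝓘(ℝ, ℝ) ∞ V
  F : ∀ q : Q, Submodule ℝ (TangentSpace 𝓘(ℝ, E) q →L[ℝ] ℝ)
  smooth_F : IsSmoothCodistribution m F

namespace SimpleMechanicalControlSystem

variable {m : ℕ} (S : SimpleMechanicalControlSystem E Q m)

/-- The value at the state `v` of the dynamics under the force `η`: the tangent vector to `TQ`
encoding the equation of motion `∇_{q'} q' = - grad V + η♯`. In the chart of `TQ` induced by the
preferred chart at the base point of `v` it reads
`q'ᵏ = vᵏ`, `v'ᵏ = (- grad V + η♯)ᵏ - ∑ Γᵏᵢⱼ vⁱ vʲ`. -/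
def forcedDynamics (v : TangentBundle 𝓘(ℝ, E) Q)
    (η : TangentSpace 𝓘(ℝ, E) v.proj →L[ℝ] ℝ) : TangentSpace 𝓘(ℝ, E).tangent v :=
  let a : TangentSpace 𝓘(ℝ, E) v.proj :=
    -riemannianGrad E S.V v.proj + sharp η - christoffel v.proj v.snd v.snd
  ((v.snd, a) : E × E)

/-- `S.forcedDynamics v η` is the tangent vector to `TQ` at `v` that lies over `v` and has covariant
acceleration `- grad V + η♯`. -/
theorem eq_forcedDynamics_iff (v : TangentBundle 𝓘(ℝ, E) Q)
    (η : TangentSpace 𝓘(ℝ, E) v.proj →L[ℝ] ℝ) (w : TangentSpace 𝓘(ℝ, E).tangent v) :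
    w = S.forcedDynamics v η ↔
      mfderiv 𝓘(ℝ, E).tangent 𝓘(ℝ, E) (TotalSpace.proj : TangentBundle 𝓘(ℝ, E) Q → Q) v w = v.snd ∧
      connector v w = -riemannianGrad E S.V v.proj + sharp η := by
  rw [mfderiv_tangentBundle_proj]
  constructor
  · rintro rfl
    refine ⟨rfl, ?_⟩
    change -riemannianGrad E S.V v.proj + sharp η - christoffel v.proj v.snd v.snd
      + christoffel v.proj v.snd v.snd = _
    rw [sub_add_cancel]
  · rintro ⟨h1, h2⟩
    have h1' : (w : E × E).1 = v.snd := h1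
    refine Prod.ext (show (w : E × E).1 = v.snd from h1) ?_
    change (show TangentSpace 𝓘(ℝ, E) v.proj from (w : E × E).2)
      = -riemannianGrad E S.V v.proj + sharp η - christoffel v.proj v.snd v.snd
    rw [← h2, connector]
    simp only [h1']
    exact (add_sub_cancel_right (show TangentSpace 𝓘(ℝ, E) v.proj from (w : E × E).2)
      (christoffel v.proj v.snd v.snd)).symm

/-- The control system on `TQ` determined by `S`: the inputs at the state `v_q` are the covectors in
the fibre `F_q` of the input codistribution. -/
def controlSystem : NonlinearControlSystem 𝓘(ℝ, E).tangent (TangentBundle 𝓘(ℝ, E) Q) where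
  Input v := S.F v.proj
  dynamics v η := S.forcedDynamics v η

/-- The unactuated distribution: the coannihilator of the input codistribution. -/
def unactuated (q : Q) : Submodule ℝ (TangentSpace 𝓘(ℝ, E) q) where
  carrier := {v | ∀ η ∈ S.F q, η v = 0}
  add_mem' hv hw η hη := by rw [map_add, hv η hη, hw η hη, add_zero]
  zero_mem' η _ := map_zero η
  smul_mem' c v hv η hη := by rw [map_smul, hv η hη, smul_zero]

/-- The actuated distribution: the orthogonal complement of the unactuated distribution. -/
def actuated (q : Q) : Submodule ℝ (TangentSpace 𝓘(ℝ, E) q) := (S.unactuated q)ᗮ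

/-- The orthogonal projection onto the actuated distribution. -/
def actuatedProj (q : Q) : TangentSpace 𝓘(ℝ, E) q →L[ℝ] TangentSpace 𝓘(ℝ, E) q :=
  (S.actuated q).starProjection

/-- The backstepping function `h(v_q) = h₀(q) - (ε / 2) ‖(v_q - κ_q)^A‖²` on `TQ`. -/
def backstepping (h₀ : Q → ℝ) (κ : ∀ q : Q, TangentSpace 𝓘(ℝ, E) q) (ε : ℝ)
    (v : TangentBundle 𝓘(ℝ, E) Q) : ℝ :=
  h₀ v.proj - ε / 2 * ‖S.actuatedProj v.proj (v.snd - κ v.proj)‖ ^ 2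

end SimpleMechanicalControlSystem

end Mechanics

/-! ### Configuration safety -/

section ConfigurationSafety

variable {E : Type*} [NormedAddCommGroup E] [NormedSpace ℝ E]
    {Q : Type*} [TopologicalSpace Q] [ChartedSpace E Q]

variable (E) in
/-- A configuration safety specification: a smooth function with regular value zero. -/
structure IsConfigurationSafetySpecification (h₀ : Q → ℝ) : Prop where
  smooth : ContMDiff 𝓘(ℝ, E) 𝓘(ℝ, ℝ) ∞ h₀
  regular : ∀ q, h₀ q = 0 → Function.Surjective (mvfderiv 𝓘(ℝ, E) h₀ q)

/-- A smooth vector field on `Q`. -/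
def IsSmoothVectorField [IsManifold 𝓘(ℝ, E) ∞ Q] (X : ∀ q : Q, TangentSpace 𝓘(ℝ, E) q) : Prop :=
  ContMDiff 𝓘(ℝ, E) 𝓘(ℝ, E).tangent ∞ (fun q ↦ (⟨q, X q⟩ : TangentBundle 𝓘(ℝ, E) Q))

/-- `κ` is a safe velocity field for `h₀` on `D₀`, with class `K_∞^e` function `α`: `κ` is smooth,
`D₀` is an open set containing `{q | 0 ≤ h₀ q}`, and `d(h₀)_q κ_q > - α (h₀ q)` on `D₀`. -/
structure IsSafeVelocityField [IsManifold 𝓘(ℝ, E) ∞ Q] (h₀ : Q → ℝ)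
    (κ : ∀ q : Q, TangentSpace 𝓘(ℝ, E) q) (D₀ : Set Q) (α : ℝ → ℝ) : Prop where
  smooth : IsSmoothVectorField κ
  classK : IsClassKInftyE α
  locallyLipschitz : LocallyLipschitz α
  isOpen : IsOpen D₀
  superlevel_subset : {q | 0 ≤ h₀ q} ⊆ D₀
  barrier : ∀ q ∈ D₀, -α (h₀ q) < mvfderiv 𝓘(ℝ, E) h₀ q (κ q)

/-- The half-Sontag function. -/
def halfSontag (a b : ℝ) : ℝ := if b = 0 then 0 else (-a + √(a ^ 2 + b ^ 2)) / (2 * b)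

open Bundle in
/-- The value at `q` of the half-Sontag safety filter for the single integrator on `Q`, with safety
function `h₀`, class `K_∞^e` function `α` and desired velocity field `κdes`:
`κdes + λ(a, b) grad h₀` with `a = α (h₀) + ⟪grad h₀, κdes⟫` and `b = ‖grad h₀‖²`. -/
def halfSontagFilter [FiniteDimensional ℝ E]
    [RiemannianBundle (fun q : Q ↦ TangentSpace 𝓘(ℝ, E) q)] (h₀ : Q → ℝ) (α : ℝ → ℝ)
    (κdes : ∀ q : Q, TangentSpace 𝓘(ℝ, E) q) (q : Q) : TangentSpace 𝓘(ℝ, E) q :=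
  κdes q + halfSontag (α (h₀ q) + inner ℝ (riemannianGrad E h₀ q) (κdes q))
    (‖riemannianGrad E h₀ q‖ ^ 2) • riemannianGrad E h₀ q

end ConfigurationSafety

end

/-!
Write `w = (v - κ)^A`, so that `h = h₀ - (ε / 2) ‖w‖²`.

The differential of `h` in the vertical direction `η♯`, with `η` in the codistribution `F`, is
`-ε ⟪w, η♯⟫`, since `η♯` is an actuated direction (`hasDerivAt_fiber_line`,
`mvfderiv_backstepping_forcedDynamics`). Changing the force alters the dynamics only by a vertical
vector, so the Christoffel symbols and the potential enter `dh Φ` only through a term that does not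
depend on the force. If `w ≠ 0`, then `w` itself is dual to an available force, because `A = F♯`
(`actuated_eq_map_sharp`); large negative multiples of it make `dh Φ` arbitrarily large. If `w = 0`,
then `h` touches `h₀ ∘ proj` from below at `v`, so their differentials agree there
(`mvfderiv_eq_of_le`) and `dh Φ = dh₀ v`. Moreover `v - κ` is then unactuated, hence in the kernel
of `dh₀`, and `dh₀ v = dh₀ κ > -α (h₀) = -α (h)`. Finally `h ≥ 0` forces `h₀ ≥ 0`.

Smoothness of `h` amounts to smoothness of `‖w‖²`. A smooth local frame of `F` has smooth dual vector
fields (`contMDiffAt_sharp`), which form a frame of `A`, and the norm of an orthogonal projection is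
a rational expression in the Gram matrix of a frame and the inner products with it
(`norm_sq_starProjection_span`). The same description, applied to a frame of `TQ`, shows that `♯`
preserves smoothness.

For the half-Sontag filter, `dh₀ κ + α (h₀) = (a + √(a² + b²)) / 2 + δ b`, which is positive when
`b ≠ 0`; when `b = 0` the differential of `h₀` vanishes and the inequality is the barrier inequality
for the single integrator.
-/

/-! ### Orthogonal projections through Gram matrices -/

section GramMatrix

variable {V : Type*} [NormedAddCommGroup V] [InnerProductSpace ℝ V]
    {ι : Type*} [Fintype ι] [DecidableEq ι]

/-- The coefficients of an orthogonal projection with respect to a basis solve the linear system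
whose matrix is the Gram matrix. -/
theorem starProjection_span_eq_sum_gram_inv {X : ι → V} (hX : LinearIndependent ℝ X)
    (W : Submodule ℝ V) [W.HasOrthogonalProjection] (hW : Submodule.span ℝ (range X) = W) (w : V) :
    W.starProjection w
      = ∑ i, ((Matrix.gram ℝ X)⁻¹.mulVec fun j ↦ inner ℝ (X j) w) i • X i := by
  have hmem : W.starProjection w ∈ Submodule.span ℝ (range X) := by
    rw [hW]
    exact W.starProjection_apply_mem w
  obtain ⟨b, hb⟩ := (Submodule.mem_span_range_iff_exists_fun ℝ).1 hmem
  have hc : (fun j ↦ inner ℝ (X j) w) = (Matrix.gram ℝ X).mulVec b := by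
    funext j
    have hj : X j ∈ W := hW ▸ Submodule.subset_span (mem_range_self j)
    have h0 : inner ℝ (X j) (w - W.starProjection w) = 0 :=
      (Submodule.mem_orthogonal W _).1 (W.sub_starProjection_mem_orthogonal w) _ hj
    rw [inner_sub_right, sub_eq_zero] at h0
    rw [h0, ← hb, inner_sum]
    simp [Matrix.mulVec, dotProduct, Matrix.gram_apply, inner_smul_right, mul_comm]
  have hdet : IsUnit (Matrix.gram ℝ X).det :=
    (Matrix.posDef_gram_of_linearIndependent (𝕜 := ℝ) hX).det_pos.ne'.isUnit
  rw [hc, Matrix.mulVec_mulVec, Matrix.nonsing_inv_mul _ hdet, Matrix.one_mulVec, hb]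

theorem norm_sq_starProjection_span {X : ι → V} (hX : LinearIndependent ℝ X)
    (W : Submodule ℝ V) [W.HasOrthogonalProjection] (hW : Submodule.span ℝ (range X) = W) (w : V) :
    ‖W.starProjection w‖ ^ 2
      = ∑ i, ((Matrix.gram ℝ X)⁻¹.mulVec fun j ↦ inner ℝ (X j) w) i * inner ℝ (X i) w := by
  have h : ‖W.starProjection w‖ ^ 2 = inner ℝ (W.starProjection w) w := by
    rw [← real_inner_self_eq_norm_sq, Submodule.inner_starProjection_left_eq_right,
      Submodule.starProjection_eq_self_iff.2 (W.starProjection_apply_mem w),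
      ← Submodule.inner_starProjection_left_eq_right]
  rw [h, starProjection_span_eq_sum_gram_inv hX W hW, sum_inner]
  simp [inner_smul_left]

end GramMatrix

/-! ### Smooth linear systems -/

section MatrixInverse

variable {EM : Type*} [NormedAddCommGroup EM] [NormedSpace ℝ EM] {HM : Type*} [TopologicalSpace HM]
    {IM : ModelWithCorners ℝ EM HM} {M : Type*} [TopologicalSpace M] [ChartedSpace HM M]
    {n : ℕ∞ω} {ι : Type*} [Fintype ι] [DecidableEq ι] {x : M}

theorem ContMDiffAt.matrix_det {A : M → Matrix ι ι ℝ}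
    (hA : ∀ i j, ContMDiffAt IM 𝓘(ℝ, ℝ) n (fun y ↦ A y i j) x) :
    ContMDiffAt IM 𝓘(ℝ, ℝ) n (fun y ↦ (A y).det) x := by
  simp only [Matrix.det_apply']
  exact ContMDiffAt.sum fun σ _ ↦ contMDiffAt_const.mul (contMDiffAt_finsetProd fun i _ ↦ hA _ _)

theorem ContMDiffAt.matrix_inv_mulVec {A : M → Matrix ι ι ℝ} {c : M → ι → ℝ}
    (hA : ∀ i j, ContMDiffAt IM 𝓘(ℝ, ℝ) n (fun y ↦ A y i j) x)
    (hc : ∀ i, ContMDiffAt IM 𝓘(ℝ, ℝ) n (fun y ↦ c y i) x) (hdet : (A x).det ≠ 0) (i : ι) :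
    ContMDiffAt IM 𝓘(ℝ, ℝ) n (fun y ↦ ((A y)⁻¹.mulVec (c y)) i) x := by
  simp only [Matrix.mulVec, dotProduct, Matrix.inv_def, Matrix.smul_apply, Ring.inverse_eq_inv',
    smul_eq_mul, Matrix.adjugate_apply]
  refine ContMDiffAt.sum fun j _ ↦ ContMDiffAt.mul (ContMDiffAt.mul ?_ ?_) (hc j)
  · exact (ContMDiffAt.matrix_det hA).inv₀ hdet
  · refine ContMDiffAt.matrix_det fun k l ↦ ?_
    simp only [Matrix.updateRow_apply]
    split_ifs
    · exact contMDiffAt_const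
    · exact hA k l

end MatrixInverse

/-! ### Smoothness of dual vector fields and gradients -/

section Sharp

open Bundle

variable {E : Type*} [NormedAddCommGroup E] [NormedSpace ℝ E] [FiniteDimensional ℝ E]
    {Q : Type*} [TopologicalSpace Q] [ChartedSpace E Q] [IsManifold 𝓘(ℝ, E) ∞ Q]
    [RiemannianBundle (fun q : Q ↦ TangentSpace 𝓘(ℝ, E) q)]
    [IsContMDiffRiemannianBundle 𝓘(ℝ, E) ∞ E (fun q : Q ↦ TangentSpace 𝓘(ℝ, E) q)]

/-- A covector field is dual to a smooth vector field as soon as it is smooth when evaluated on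
smooth vector fields. -/
theorem contMDiffAt_sharp {η : ∀ q : Q, TangentSpace 𝓘(ℝ, E) q →L[ℝ] ℝ} {q₀ : Q}
    (hη : ∀ X : ∀ q : Q, TangentSpace 𝓘(ℝ, E) q,
      ContMDiffAt 𝓘(ℝ, E) 𝓘(ℝ, E).tangent ∞ (fun q ↦ (⟨q, X q⟩ : TangentBundle 𝓘(ℝ, E) Q)) q₀ →
      ContMDiffAt 𝓘(ℝ, E) 𝓘(ℝ, ℝ) ∞ (fun q ↦ η q (X q)) q₀) :
    ContMDiffAt 𝓘(ℝ, E) 𝓘(ℝ, E).tangent ∞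
      (fun q ↦ (⟨q, sharp (η q)⟩ : TangentBundle 𝓘(ℝ, E) Q)) q₀ := by
  let b := Module.finBasis ℝ E
  let e := trivializationAt E (TangentSpace 𝓘(ℝ, E) : Q → Type _) q₀
  have hq₀ : q₀ ∈ e.baseSet := mem_baseSet_trivializationAt E (TangentSpace 𝓘(ℝ, E)) q₀
  let X := e.localFrame b
  have hX : IsLocalFrameOn 𝓘(ℝ, E) E ∞ X e.baseSet :=
    e.isLocalFrameOn_localFrame_baseSet 𝓘(ℝ, E) ∞ b
  have hXs : ∀ i, ContMDiffAt 𝓘(ℝ, E) 𝓘(ℝ, E).tangent ∞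
      (fun q ↦ (⟨q, X i q⟩ : TangentBundle 𝓘(ℝ, E) Q)) q₀ :=
    fun i ↦ hX.contMDiffAt e.open_baseSet hq₀ i
  have heq : ∀ q ∈ e.baseSet, sharp (η q)
      = ∑ i, ((Matrix.gram ℝ fun k ↦ X k q)⁻¹.mulVec fun j ↦ η q (X j q)) i • X i q := by
    intro q hq
    have h := starProjection_span_eq_sum_gram_inv (hX.linearIndependent hq) ⊤
      (top_le_iff.1 (hX.generating hq)) (sharp (η q))
    rw [Submodule.starProjection_top] at h
    refine Eq.trans h ?_
    simp_rw [real_inner_comm, inner_sharp]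
  have hs : ContMDiffAt 𝓘(ℝ, E) 𝓘(ℝ, E).tangent ∞
      (fun q ↦ (⟨q, ∑ i, ((Matrix.gram ℝ fun k ↦ X k q)⁻¹.mulVec fun j ↦ η q (X j q)) i • X i q⟩ :
        TangentBundle 𝓘(ℝ, E) Q)) q₀ := by
    refine ContMDiffAt.sum_section fun i _ ↦ ContMDiffAt.smul_section ?_ (hXs i)
    refine ContMDiffAt.matrix_inv_mulVec (fun k l ↦ ?_) (fun j ↦ hη _ (hXs j)) ?_ i
    · exact ContMDiffAt.inner_bundle (F := E) (E := fun q : Q ↦ TangentSpace 𝓘(ℝ, E) q)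
        (b := id) (v := X k) (w := X l) (hXs k) (hXs l)
    · exact (Matrix.posDef_gram_of_linearIndependent (𝕜 := ℝ)
        (hX.linearIndependent hq₀)).det_pos.ne'
  refine hs.congr_of_eventuallyEq ?_
  filter_upwards [e.open_baseSet.mem_nhds hq₀] with q hq
  rw [heq q hq]

/-- The Riemannian gradient of a smooth function is a smooth vector field. -/
theorem isSmoothVectorField_riemannianGrad {f : Q → ℝ} (hf : ContMDiff 𝓘(ℝ, E) 𝓘(ℝ, ℝ) ∞ f) :
    IsSmoothVectorField (riemannianGrad E f) := by
  intro q₀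
  refine contMDiffAt_sharp fun X hX ↦ ?_
  have h1 : ContMDiff 𝓘(ℝ, E).tangent 𝓘(ℝ, ℝ).tangent ∞ (tangentMap 𝓘(ℝ, E) 𝓘(ℝ, ℝ) f) :=
    hf.contMDiff_tangentMap le_rfl
  exact ((contMDiff_snd_tangentBundle_modelSpace ℝ 𝓘(ℝ, ℝ)).contMDiffAt).comp q₀
    (h1.contMDiffAt.comp q₀ hX)

end Sharp

/-! ### Differentials of functions on the tangent bundle -/

section VerticalDerivative

open Bundle

variable {E : Type*} [NormedAddCommGroup E] [NormedSpace ℝ E]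
    {Q : Type*} [TopologicalSpace Q] [ChartedSpace E Q] [IsManifold 𝓘(ℝ, E) ∞ Q]

theorem MDifferentiableAt.hasFDerivAt_comp_extChartAt_symm {EM : Type*} [NormedAddCommGroup EM]
    [NormedSpace ℝ EM] {HM : Type*} [TopologicalSpace HM] {I : ModelWithCorners ℝ EM HM}
    [I.Boundaryless] {M : Type*} [TopologicalSpace M] [ChartedSpace HM M] {f : M → ℝ} {p : M}
    (hf : MDifferentiableAt I 𝓘(ℝ, ℝ) f p) :
    HasFDerivAt (𝕜 := ℝ) (E := EM) (F := ℝ) (f ∘ (extChartAt I p).symm)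
      (mvfderiv I f p : EM →L[ℝ] ℝ) (extChartAt I p p) := by
  let L : EM →L[ℝ] ℝ := mvfderiv I f p
  have h : HasFDerivWithinAt (f ∘ (extChartAt I p).symm) L (range I) (extChartAt I p p) :=
    hf.hasMFDerivAt.2
  rw [ModelWithCorners.range_eq_univ, hasFDerivWithinAt_univ] at h
  exact h

/-- The chart of `TQ` at `v` restricts to the identity of the fibre through `v`. -/
theorem extChartAt_tangent_fiber (v : TangentBundle 𝓘(ℝ, E) Q) (u : E) :
    extChartAt 𝓘(ℝ, E).tangent v ⟨v.proj, u⟩ = (extChartAt 𝓘(ℝ, E) v.proj v.proj, u) :=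
  Prod.ext (TangentBundle.coe_chartAt_fst _ v)
    (tangentCoordChange_self (I := 𝓘(ℝ, E)) (mem_extChartAt_source v.proj))

theorem extChartAt_tangent_symm_fiber (v : TangentBundle 𝓘(ℝ, E) Q) (u : E) :
    (extChartAt 𝓘(ℝ, E).tangent v).symm (extChartAt 𝓘(ℝ, E) v.proj v.proj, u)
      = ⟨v.proj, u⟩ := by
  have hs : (⟨v.proj, u⟩ : TangentBundle 𝓘(ℝ, E) Q) ∈ (extChartAt 𝓘(ℝ, E).tangent v).source := by
    rw [extChartAt_source, TangentBundle.mem_chart_source_iff]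
    exact mem_chart_source E v.proj
  rw [← extChartAt_tangent_fiber v u, (extChartAt 𝓘(ℝ, E).tangent v).left_inv hs]

/-- The differential of a function on `TQ` in a vertical direction is its derivative along a line
in the fibre. -/
theorem hasDerivAt_fiber_line {h : TangentBundle 𝓘(ℝ, E) Q → ℝ} (v : TangentBundle 𝓘(ℝ, E) Q)
    (hh : MDifferentiableAt 𝓘(ℝ, E).tangent 𝓘(ℝ, ℝ) h v) (u : TangentSpace 𝓘(ℝ, E) v.proj) :
    HasDerivAt (fun t : ℝ ↦ h ⟨v.proj, v.snd + t • u⟩)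
      (mvfderiv 𝓘(ℝ, E).tangent h v ((0, u) : E × E)) 0 := by
  let x₀ := extChartAt 𝓘(ℝ, E) v.proj v.proj
  let v' : E := v.snd
  let u' : E := u
  have hc : HasDerivAt (fun t : ℝ ↦ ((x₀, v' + t • u') : E × E)) ((0, u') : E × E) 0 := by
    refine (hasDerivAt_const _ _).prodMk ?_
    simpa using ((hasDerivAt_id (0 : ℝ)).smul_const u').const_add v'
  have h0 : extChartAt 𝓘(ℝ, E).tangent v v = (x₀, v' + (0 : ℝ) • u') := by
    rw [zero_smul, add_zero]
    exact extChartAt_tangent_fiber v v'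
  have hd := hh.hasFDerivAt_comp_extChartAt_symm
  rw [h0] at hd
  refine (HasFDerivAt.comp_hasDerivAt (0 : ℝ) hd hc).congr_of_eventuallyEq
    (Eventually.of_forall fun t ↦ ?_)
  exact congrArg h (extChartAt_tangent_symm_fiber v (v' + t • u')).symm

/-- If one function lies below another and touches it at a point, their differentials agree
there. -/
theorem mvfderiv_eq_of_le {EM : Type*} [NormedAddCommGroup EM] [NormedSpace ℝ EM]
    {HM : Type*} [TopologicalSpace HM] {I : ModelWithCorners ℝ EM HM} [I.Boundaryless]
    {M : Type*} [TopologicalSpace M] [ChartedSpace HM M] {f g : M → ℝ} {p : M}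
    (hf : MDifferentiableAt I 𝓘(ℝ, ℝ) f p) (hg : MDifferentiableAt I 𝓘(ℝ, ℝ) g p)
    (hle : ∀ x, f x ≤ g x) (heq : f p = g p) : mvfderiv I f p = mvfderiv I g p := by
  have hmin : IsLocalMin (g ∘ (extChartAt I p).symm - f ∘ (extChartAt I p).symm)
      (extChartAt I p p) :=
    Eventually.of_forall fun x ↦ by simpa [heq] using hle _
  have h0 := hmin.hasFDerivAt_eq_zero
    (hg.hasFDerivAt_comp_extChartAt_symm.sub hf.hasFDerivAt_comp_extChartAt_symm)
  exact (sub_eq_zero.1 h0).symm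

end VerticalDerivative

/-! ### Actuated directions and the backstepping function -/

section Backstepping

open Bundle

variable {E : Type*} [NormedAddCommGroup E] [NormedSpace ℝ E] [FiniteDimensional ℝ E]
    {Q : Type*} [TopologicalSpace Q] [ChartedSpace E Q]
    [RiemannianBundle (fun q : Q ↦ TangentSpace 𝓘(ℝ, E) q)]

variable (E) in
/-- The musical isomorphism `♯` as a linear map. -/
noncomputable def sharpLinearMap (q : Q) :
    (TangentSpace 𝓘(ℝ, E) q →L[ℝ] ℝ) →ₗ[ℝ] TangentSpace 𝓘(ℝ, E) q where
  toFun := sharp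
  map_add' := map_add (InnerProductSpace.toDual ℝ (TangentSpace 𝓘(ℝ, E) q)).symm
  map_smul' c η := (InnerProductSpace.toDual ℝ (TangentSpace 𝓘(ℝ, E) q)).symm.map_smulₛₗ c η

theorem sharpLinearMap_apply {q : Q} (η : TangentSpace 𝓘(ℝ, E) q →L[ℝ] ℝ) :
    sharpLinearMap E q η = sharp η := rfl

theorem sharpLinearMap_injective (q : Q) : Function.Injective (sharpLinearMap E q) :=
  (InnerProductSpace.toDual ℝ (TangentSpace 𝓘(ℝ, E) q)).symm.injective

variable [IsManifold 𝓘(ℝ, E) ∞ Q]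

namespace SimpleMechanicalControlSystem

variable {m : ℕ} (S : SimpleMechanicalControlSystem E Q m)

/-- The actuated directions are those dual to the available forces. -/
theorem actuated_eq_map_sharp (q : Q) : S.actuated q = (S.F q).map (sharpLinearMap E q) := by
  have h : S.unactuated q = ((S.F q).map (sharpLinearMap E q))ᗮ := by
    ext v
    simp only [Submodule.mem_orthogonal, Submodule.mem_map, forall_exists_index, and_imp,
      forall_apply_eq_imp_iff₂, sharpLinearMap_apply, inner_sharp]
    rfl
  rw [actuated, h, Submodule.orthogonal_orthogonal]

theorem actuatedProj_mem (q : Q) (w : TangentSpace 𝓘(ℝ, E) q) :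
    S.actuatedProj q w ∈ S.actuated q :=
  (S.actuated q).starProjection_apply_mem w

theorem mem_unactuated_of_actuatedProj_eq_zero {q : Q} {w : TangentSpace 𝓘(ℝ, E) q}
    (hw : S.actuatedProj q w = 0) : w ∈ S.unactuated q := by
  have h := (S.actuated q).sub_starProjection_mem_orthogonal w
  change w - S.actuatedProj q w ∈ _ at h
  rwa [hw, sub_zero, actuated, Submodule.orthogonal_orthogonal] at h

theorem forcedDynamics_eq_add (v : TangentBundle 𝓘(ℝ, E) Q)
    (η : TangentSpace 𝓘(ℝ, E) v.proj →L[ℝ] ℝ) :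
    S.forcedDynamics v η
      = S.forcedDynamics v 0 + (show TangentSpace 𝓘(ℝ, E).tangent v from
          ((0, (sharp η : TangentSpace 𝓘(ℝ, E) v.proj)) : E × E)) := by
  have h0 : sharp (0 : TangentSpace 𝓘(ℝ, E) v.proj →L[ℝ] ℝ) = 0 :=
    map_zero (sharpLinearMap E v.proj)
  have key : ∀ a b c z : TangentSpace 𝓘(ℝ, E) v.proj, z = 0 → a + b - c = a + z - c + b := by
    rintro a b c _ rfl
    abel
  exact Prod.ext (add_zero v.snd).symm (key _ _ _ _ h0)

/-- Near each point, the covector fields spanning the codistribution have smooth duals that form a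
frame of the actuated distribution. The Gram matrix of this frame expresses the norm of the
projection through inner products of smooth maps into `TQ`. -/
theorem contMDiff_norm_sq_actuatedProj_sub {κ : ∀ q : Q, TangentSpace 𝓘(ℝ, E) q}
    (hκ : IsSmoothVectorField κ) :
    ContMDiff 𝓘(ℝ, E).tangent 𝓘(ℝ, ℝ) ∞ (fun v : TangentBundle 𝓘(ℝ, E) Q ↦
      ‖S.actuatedProj v.proj (v.snd - κ v.proj)‖ ^ 2) := by
  have := S.smooth_metric
  intro v₀
  obtain ⟨U, hU, hmem, η, hη, hspan⟩ := S.smooth_F v₀.proj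
  have hproj : ContMDiff 𝓘(ℝ, E).tangent 𝓘(ℝ, E) ∞
      (TotalSpace.proj : TangentBundle 𝓘(ℝ, E) Q → Q) := contMDiff_proj _
  -- a smooth local frame of the actuated distribution
  let X : Fin m → ∀ q : Q, TangentSpace 𝓘(ℝ, E) q := fun i q ↦ sharp (η i q)
  have hηX : ∀ i (Y : ∀ q : Q, TangentSpace 𝓘(ℝ, E) q),
      ContMDiffAt 𝓘(ℝ, E) 𝓘(ℝ, E).tangent ∞
        (fun q ↦ (⟨q, Y q⟩ : TangentBundle 𝓘(ℝ, E) Q)) v₀.proj →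
      ContMDiffAt 𝓘(ℝ, E) 𝓘(ℝ, ℝ) ∞ (fun q ↦ η i q (Y q)) v₀.proj := by
    intro i Y hY
    have h := ContMDiffAt.clm_bundle_apply (F₁ := E) (F₂ := ℝ)
      (E₁ := fun q : Q ↦ TangentSpace 𝓘(ℝ, E) q) (E₂ := Bundle.Trivial Q ℝ) (b := id)
      (ϕ := η i) (v := Y) ((hη i).contMDiffAt (hU.mem_nhds hmem)) hY
    exact (contMDiffAt_totalSpace.1 h).2
  have hX : ∀ i, ContMDiffAt 𝓘(ℝ, E) 𝓘(ℝ, E).tangent ∞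
      (fun q ↦ (⟨q, X i q⟩ : TangentBundle 𝓘(ℝ, E) Q)) v₀.proj :=
    fun i ↦ contMDiffAt_sharp (hηX i)
  have hli : ∀ q ∈ U, LinearIndependent ℝ (fun i ↦ X i q) := fun q hq ↦
    (hspan q hq).1.map' (sharpLinearMap E q) (LinearMap.ker_eq_bot.2 (sharpLinearMap_injective q))
  have hsp : ∀ q ∈ U, Submodule.span ℝ (range fun i ↦ X i q) = S.actuated q := by
    intro q hq
    rw [S.actuated_eq_map_sharp, ← (hspan q hq).2, Submodule.map_span, ← range_comp]
    rfl
  have hXv : ∀ i, ContMDiffAt 𝓘(ℝ, E).tangent 𝓘(ℝ, E).tangent ∞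
      (fun v : TangentBundle 𝓘(ℝ, E) Q ↦ (⟨v.proj, X i v.proj⟩ : TangentBundle 𝓘(ℝ, E) Q)) v₀ :=
    fun i ↦ (hX i).comp v₀ hproj.contMDiffAt
  have hc : ∀ i, ContMDiffAt 𝓘(ℝ, E).tangent 𝓘(ℝ, ℝ) ∞
      (fun v : TangentBundle 𝓘(ℝ, E) Q ↦ inner ℝ (X i v.proj) (v.snd - κ v.proj)) v₀ := by
    intro i
    simp only [inner_sub_right]
    refine ContMDiffAt.sub ?_ ?_
    · exact ContMDiffAt.inner_bundle (F := E) (E := fun q : Q ↦ TangentSpace 𝓘(ℝ, E) q)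
        (b := fun v : TangentBundle 𝓘(ℝ, E) Q ↦ v.proj)
        (v := fun v ↦ X i v.proj) (w := fun v ↦ v.snd) (hXv i) contMDiffAt_id
    · exact ContMDiffAt.inner_bundle (F := E) (E := fun q : Q ↦ TangentSpace 𝓘(ℝ, E) q)
        (b := fun v : TangentBundle 𝓘(ℝ, E) Q ↦ v.proj)
        (v := fun v ↦ X i v.proj) (w := fun v ↦ κ v.proj) (hXv i)
        ((hκ _).comp v₀ hproj.contMDiffAt)
  have hs : ContMDiffAt 𝓘(ℝ, E).tangent 𝓘(ℝ, ℝ) ∞ (fun v : TangentBundle 𝓘(ℝ, E) Q ↦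
      ∑ i, ((Matrix.gram ℝ fun k ↦ X k v.proj)⁻¹.mulVec
        fun j ↦ inner ℝ (X j v.proj) (v.snd - κ v.proj)) i
          * inner ℝ (X i v.proj) (v.snd - κ v.proj)) v₀ := by
    refine ContMDiffAt.sum fun i _ ↦ ContMDiffAt.mul ?_ (hc i)
    refine ContMDiffAt.matrix_inv_mulVec (fun k l ↦ ?_) hc ?_ i
    · exact ContMDiffAt.inner_bundle (F := E) (E := fun q : Q ↦ TangentSpace 𝓘(ℝ, E) q)
        (b := fun v : TangentBundle 𝓘(ℝ, E) Q ↦ v.proj)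
        (v := fun v ↦ X k v.proj) (w := fun v ↦ X l v.proj) (hXv k) (hXv l)
    · exact (Matrix.posDef_gram_of_linearIndependent (𝕜 := ℝ) (hli _ hmem)).det_pos.ne'
  refine hs.congr_of_eventuallyEq ?_
  filter_upwards [hproj.continuous.continuousAt.preimage_mem_nhds (hU.mem_nhds hmem)] with v hv
  exact norm_sq_starProjection_span (hli _ hv) _ (hsp _ hv) _

theorem contMDiff_backstepping {h₀ : Q → ℝ} (hh₀ : ContMDiff 𝓘(ℝ, E) 𝓘(ℝ, ℝ) ∞ h₀)
    {κ : ∀ q : Q, TangentSpace 𝓘(ℝ, E) q} (hκ : IsSmoothVectorField κ) (ε : ℝ) :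
    ContMDiff 𝓘(ℝ, E).tangent 𝓘(ℝ, ℝ) ∞ (S.backstepping h₀ κ ε) :=
  (hh₀.comp (contMDiff_proj _)).sub
    (contMDiff_const.mul (S.contMDiff_norm_sq_actuatedProj_sub hκ))

theorem backstepping_le (h₀ : Q → ℝ) (κ : ∀ q : Q, TangentSpace 𝓘(ℝ, E) q) {ε : ℝ} (hε : 0 < ε)
    (v : TangentBundle 𝓘(ℝ, E) Q) : S.backstepping h₀ κ ε v ≤ h₀ v.proj := by
  rw [backstepping]
  have : 0 ≤ ε / 2 * ‖S.actuatedProj v.proj (v.snd - κ v.proj)‖ ^ 2 := by positivity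
  linarith

/-- The rate of change of the backstepping function under the force `η` is affine in `η`, with
linear part `-ε ⟪(v - κ)^A, η♯⟫`. -/
theorem mvfderiv_backstepping_forcedDynamics {h₀ : Q → ℝ}
    (hh₀ : ContMDiff 𝓘(ℝ, E) 𝓘(ℝ, ℝ) ∞ h₀)
    {κ : ∀ q : Q, TangentSpace 𝓘(ℝ, E) q} (hκ : IsSmoothVectorField κ) (ε : ℝ)
    (v : TangentBundle 𝓘(ℝ, E) Q) {η : TangentSpace 𝓘(ℝ, E) v.proj →L[ℝ] ℝ}
    (hη : η ∈ S.F v.proj) :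
    mvfderiv 𝓘(ℝ, E).tangent (S.backstepping h₀ κ ε) v (S.forcedDynamics v η)
      = mvfderiv 𝓘(ℝ, E).tangent (S.backstepping h₀ κ ε) v (S.forcedDynamics v 0)
        - ε * inner ℝ (S.actuatedProj v.proj (v.snd - κ v.proj)) (sharp η) := by
  have hd := hasDerivAt_fiber_line v
    ((S.contMDiff_backstepping hh₀ hκ ε).mdifferentiableAt (by simp)) (sharp η)
  have hPη : S.actuatedProj v.proj (sharp η) = sharp η := by
    refine Submodule.starProjection_eq_self_iff.2 ?_
    rw [S.actuated_eq_map_sharp]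
    exact ⟨η, hη, rfl⟩
  have hline : ∀ t : ℝ, S.actuatedProj v.proj (v.snd + t • sharp η - κ v.proj)
      = S.actuatedProj v.proj (v.snd - κ v.proj) + t • sharp η := by
    intro t
    rw [add_sub_right_comm, map_add, map_smul, hPη]
  have hd' : HasDerivAt
      (fun t : ℝ ↦ S.backstepping h₀ κ ε ⟨v.proj, v.snd + t • sharp η⟩)
      (-(ε * inner ℝ (S.actuatedProj v.proj (v.snd - κ v.proj)) (sharp η))) 0 := by
    simp only [backstepping, hline]
    have h1 : HasDerivAt (fun t : ℝ ↦ S.actuatedProj v.proj (v.snd - κ v.proj) + t • sharp η)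
        (sharp η) 0 := by
      simpa using ((hasDerivAt_id (0 : ℝ)).smul_const (sharp η)).const_add
        (S.actuatedProj v.proj (v.snd - κ v.proj))
    refine ((h1.norm_sq.const_mul (ε / 2)).const_sub (h₀ v.proj)).congr_deriv ?_
    rw [zero_smul, add_zero]
    ring
  rw [S.forcedDynamics_eq_add v η, map_add, sub_eq_add_neg]
  exact congrArg _ (hd.unique hd')

/-- Where `(v - κ)^A ≠ 0` the forces make the rate of change of the backstepping function
arbitrarily large; where `(v - κ)^A = 0` the barrier inequality for `κ` applies, because `h₀` only
sees the actuated part of the velocity. -/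
theorem isCBFOnWith_backstepping {h₀ : Q → ℝ} (hh₀ : ContMDiff 𝓘(ℝ, E) 𝓘(ℝ, ℝ) ∞ h₀)
    {κ : ∀ q : Q, TangentSpace 𝓘(ℝ, E) q} {D₀ : Set Q} {α : ℝ → ℝ}
    (hsafe : IsSafeVelocityField h₀ κ D₀ α)
    (hker : ∀ q ∈ D₀, ∀ v ∈ S.unactuated q, mvfderiv 𝓘(ℝ, E) h₀ q v = 0) {ε : ℝ} (hε : 0 < ε) :
    S.controlSystem.IsCBFOnWith (S.backstepping h₀ κ ε) (TotalSpace.proj ⁻¹' D₀) α where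
  smooth := S.contMDiff_backstepping hh₀ hsafe.smooth ε
  classK := hsafe.classK
  locallyLipschitz := hsafe.locallyLipschitz
  isOpen := hsafe.isOpen.preimage
    (contMDiff_proj (n := ∞) (IB := 𝓘(ℝ, E)) (F := E) (TangentSpace 𝓘(ℝ, E) : Q → Type _)).continuous
  superlevel_subset v hv := hsafe.superlevel_subset (le_trans hv (S.backstepping_le h₀ κ hε v))
  barrier v hv := by
    set w := S.actuatedProj v.proj (v.snd - κ v.proj) with hw
    have hsm := S.contMDiff_backstepping hh₀ hsafe.smooth ε
    suffices ∃ η ∈ S.F v.proj, -α (S.backstepping h₀ κ ε v)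
        < mvfderiv 𝓘(ℝ, E).tangent (S.backstepping h₀ κ ε) v (S.forcedDynamics v η) by
      obtain ⟨η, hη, hlt⟩ := this
      exact (EReal.coe_lt_coe_iff.2 hlt).trans_le
        (le_iSup (fun u : S.F v.proj ↦ ((mvfderiv 𝓘(ℝ, E).tangent (S.backstepping h₀ κ ε) v
          (S.forcedDynamics v u) : ℝ) : EReal)) ⟨η, hη⟩)
    by_cases hw0 : w = 0
    · -- the subtracted square vanishes to second order, so that `dh = d(h₀ ∘ proj)` at `v`
      refine ⟨0, zero_mem _, ?_⟩
      have heq : S.backstepping h₀ κ ε v = h₀ v.proj := by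
        rw [backstepping, ← hw, hw0, norm_zero]
        simp
      have hproj : MDifferentiableAt 𝓘(ℝ, E).tangent 𝓘(ℝ, E)
          (TotalSpace.proj : TangentBundle 𝓘(ℝ, E) Q → Q) v :=
        (contMDiffAt_proj (n := 1) (TangentSpace 𝓘(ℝ, E))).mdifferentiableAt one_ne_zero
      have hh₀v : MDifferentiableAt 𝓘(ℝ, E) 𝓘(ℝ, ℝ) h₀ v.proj := hh₀.mdifferentiableAt (by simp)
      have hmf : mvfderiv 𝓘(ℝ, E).tangent (S.backstepping h₀ κ ε) v
          = mvfderiv 𝓘(ℝ, E).tangent (h₀ ∘ TotalSpace.proj) v :=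
        mvfderiv_eq_of_le (hsm.mdifferentiableAt (by simp)) (hh₀v.comp v hproj)
          (S.backstepping_le h₀ κ hε) heq
      have hκv : mvfderiv 𝓘(ℝ, E) h₀ v.proj v.snd = mvfderiv 𝓘(ℝ, E) h₀ v.proj (κ v.proj) := by
        rw [← sub_eq_zero, ← map_sub]
        exact hker _ hv _ (S.mem_unactuated_of_actuatedProj_eq_zero hw0)
      rw [heq, hmf, mvfderiv_comp_apply v hh₀v hproj, mfderiv_tangentBundle_proj]
      change _ < mvfderiv 𝓘(ℝ, E) h₀ v.proj v.snd
      rw [hκv]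
      exact hsafe.barrier _ hv
    · have hwA : w ∈ (S.F v.proj).map (sharpLinearMap E v.proj) := by
        rw [← S.actuated_eq_map_sharp]
        exact S.actuatedProj_mem _ _
      obtain ⟨η, hη, hηw⟩ := hwA
      rw [sharpLinearMap_apply] at hηw
      have hpos : 0 < ε * ‖w‖ ^ 2 := by positivity
      -- the force `-t w♭` contributes `t ε ‖w‖²`, which is unbounded in `t`
      obtain ⟨t, ht⟩ := exists_lt_nsmul hpos (-α (S.backstepping h₀ κ ε v)
        - mvfderiv 𝓘(ℝ, E).tangent (S.backstepping h₀ κ ε) v (S.forcedDynamics v 0))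
      have hsη : sharp ((-(t : ℝ)) • η) = (-(t : ℝ)) • w := by
        rw [← sharpLinearMap_apply, map_smul, sharpLinearMap_apply, hηw]
      refine ⟨(-(t : ℝ)) • η, Submodule.smul_mem _ _ hη, ?_⟩
      rw [S.mvfderiv_backstepping_forcedDynamics hh₀ hsafe.smooth ε v (Submodule.smul_mem _ _ hη),
        hsη, ← hw, inner_smul_right, real_inner_self_eq_norm_sq]
      rw [nsmul_eq_mul] at ht
      linarith

end SimpleMechanicalControlSystem

/-! ### The half-Sontag safety filter -/

/-- Away from `b = 0`, the half-Sontag filter makes the barrier inequality `0 ≤ a + λ b` strict by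
a margin `(a + √(a² + b²)) / 2 > 0`. -/
theorem halfSontag_margin_pos (a : ℝ) {b : ℝ} (hb : b ≠ 0) : 0 < a + halfSontag a b * b := by
  have h : |a| < √(a ^ 2 + b ^ 2) := by
    rw [← Real.sqrt_sq_eq_abs]
    exact Real.sqrt_lt_sqrt (sq_nonneg a) (lt_add_of_pos_right _ (by positivity))
  have h' : a + halfSontag a b * b = (a + √(a ^ 2 + b ^ 2)) / 2 := by
    rw [halfSontag, if_neg hb]
    field_simp
    ring
  rw [h']
  linarith [neg_abs_le a]

/-- The half-Sontag filter is strictly safe wherever `grad h₀ ≠ 0`. Where `grad h₀ = 0` the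
differential of `h₀` vanishes, and the barrier inequality for the single integrator already says
that `0 > -α (h₀)`. -/
theorem isSafeVelocityField_halfSontag_add_grad
    [IsContMDiffRiemannianBundle 𝓘(ℝ, E) ∞ E (fun q : Q ↦ TangentSpace 𝓘(ℝ, E) q)]
    {h₀ : Q → ℝ} {D D₀ : Set Q} {α : ℝ → ℝ} {κdes κHS : ∀ q : Q, TangentSpace 𝓘(ℝ, E) q} {δ : ℝ}
    (hcbf : (singleIntegrator 𝓘(ℝ, E) Q).IsCBFOnWith h₀ D α) (hHS : IsSmoothVectorField κHS)
    (hD₀ : IsOpen D₀) (hsub : {q | 0 ≤ h₀ q} ⊆ D₀) (hD : D₀ ⊆ D)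
    (heq : ∀ q ∈ D₀, κHS q = halfSontagFilter h₀ α κdes q) (hδ : 0 < δ) :
    IsSafeVelocityField h₀ (fun q ↦ κHS q + δ • riemannianGrad E h₀ q) D₀ α where
  smooth := ContMDiff.add_section hHS
    (ContMDiff.const_smul_section (isSmoothVectorField_riemannianGrad hcbf.smooth))
  classK := hcbf.classK
  locallyLipschitz := hcbf.locallyLipschitz
  isOpen := hD₀
  superlevel_subset := hsub
  barrier q hq := by
    have hgrad : ∀ u : TangentSpace 𝓘(ℝ, E) q,
        mvfderiv 𝓘(ℝ, E) h₀ q u = inner ℝ (riemannianGrad E h₀ q) u :=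
      fun u ↦ (inner_sharp _ u).symm
    simp only [hgrad, heq q hq, halfSontagFilter, inner_add_right, inner_smul_right,
      real_inner_self_eq_norm_sq]
    by_cases hb : ‖riemannianGrad E h₀ q‖ ^ 2 = 0
    · have h0 : riemannianGrad E h₀ q = 0 := by simpa using hb
      have hbar := hcbf.barrier q (hD hq)
      obtain ⟨u, hu⟩ := lt_iSup_iff.1 hbar
      have hu' := EReal.coe_lt_coe_iff.1 hu
      rw [hgrad, h0, inner_zero_left] at hu'
      simpa [h0] using hu'
    · have hpos : 0 < δ * ‖riemannianGrad E h₀ q‖ ^ 2 :=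
        mul_pos hδ (lt_of_le_of_ne (sq_nonneg _) (Ne.symm hb))
      have := halfSontag_margin_pos
        (α (h₀ q) + inner ℝ (riemannianGrad E h₀ q) (κdes q)) hb
      linarith

end Backstepping

theorem mainTheorem1 {E : Type*} [NormedAddCommGroup E] [NormedSpace ℝ E] [FiniteDimensional ℝ E]
    {Q : Type*} [TopologicalSpace Q] [T2Space Q] [SecondCountableTopology Q] [ChartedSpace E Q]
    [IsManifold 𝓘(ℝ, E) ∞ Q]
    [Bundle.RiemannianBundle (fun q : Q ↦ TangentSpace 𝓘(ℝ, E) q)]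
    {m : ℕ} (S : SimpleMechanicalControlSystem E Q m)
    (h₀ : Q → ℝ) (hh₀ : IsConfigurationSafetySpecification E h₀) :
    -- every safe velocity field `κ` on `D₀`
    (∀ (κ : ∀ q : Q, TangentSpace 𝓘(ℝ, E) q) (D₀ : Set Q) (α : ℝ → ℝ),
      IsSafeVelocityField h₀ κ D₀ α →
      (∀ q ∈ D₀, ∀ v ∈ S.unactuated q, mvfderiv 𝓘(ℝ, E) h₀ q v = 0) →
      ∀ ε : ℝ, 0 < ε →
        S.controlSystem.IsCBFOnWith (S.backstepping h₀ κ ε) (Bundle.TotalSpace.proj ⁻¹' D₀) α) ∧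
    -- in particular `κ = κHS + δ grad h₀`, with `κHS` a half-Sontag safety filter on `D₀`
    (∀ (D D₀ : Set Q) (α : ℝ → ℝ) (κdes κHS : ∀ q : Q, TangentSpace 𝓘(ℝ, E) q) (δ : ℝ),
      ContDiff ℝ ∞ α → (singleIntegrator 𝓘(ℝ, E) Q).IsCBFOnWith h₀ D α →
      IsSmoothVectorField κdes → IsSmoothVectorField κHS →
      IsOpen D₀ → {q | 0 ≤ h₀ q} ⊆ D₀ → D₀ ⊆ D →
      (∀ q ∈ D₀, κHS q = halfSontagFilter h₀ α κdes q) → 0 < δ →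
      (∀ q ∈ D₀, ∀ v ∈ S.unactuated q, mvfderiv 𝓘(ℝ, E) h₀ q v = 0) →
      ∀ ε : ℝ, 0 < ε →
        S.controlSystem.IsCBFOnWith
          (S.backstepping h₀ (fun q ↦ κHS q + δ • riemannianGrad E h₀ q) ε)
          (Bundle.TotalSpace.proj ⁻¹' D₀) α) := by
  have := S.smooth_metric
  exact ⟨fun κ D₀ α hsafe hker ε hε ↦ S.isCBFOnWith_backstepping hh₀.smooth hsafe hker hε,
    fun D D₀ α κdes κHS δ _ hcbf _ hHS hD₀ hsub hD heq hδ hker ε hε ↦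
      S.isCBFOnWith_backstepping hh₀.smooth
        (isSafeVelocityField_halfSontag_add_grad hcbf hHS hD₀ hsub hD heq hδ) hker hε⟩
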